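/- Let $(\Omega,\mu)$ be a totally $\sigma$-finite measure space with a non-atomic measure $\mu$, and let $\mathcal M(\Omega,\mu)$ be the set of all (real- or complex-valued) $\mu$-measurable functions on $\Omega$, functions equal $\mu$-a.e. being identified. For $f\in\mathcal M(\Omega,\mu)$ and $t>0$ put $$f^*(t)=\inf\{\lambda\ge 0:\ \mu(\{|f|>\lambda\})\le t\},\qquad f^{**}(t)=\frac1t\int_0^t f^*(u)\,du .$$ A positive Lebesgue measurable function $b$ on $(0,\infty)$ is called slowly varying, $b\in SV$, if for each $\varepsilon>0$ the function $t^{\varepsilon}b(t)$ is equivalent to a non-decreasing function and $t^{-\varepsilon}b(t)$ is equivalent to a non-increasing function (two functions being equivalent if each is bounded by a constant multiple of the other). Write $\|\cdot\|_{q,(s,t)}$ for the (quasi-)norm of $L_q$ on the interval $(s,t)$ with Lebesgue measure, $L_{1,\infty}$ for the space of all $f\in\mathcal M(\Omega,\mu)$ with $\|f\|_{1,\infty}=\|tf^*(t)\|_{\infty,(0,\infty)}<\infty$, and $$K(t,f;A_0,A_1)=\inf\{\|f_0\|_{A_0}+t\|f_1\|_{A_1}:\ f=f_0+f_1,\ f_i\in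 A_i\}.$$ Let $0<\theta\le1$, $p=\frac1{1-\theta}$ (so $p=\infty$ if $\theta=1$; $1/\infty=0$), $0<q,r\le\infty$ and $a,b\in SV$. For $A_0=L_1$ or $A_0=L_{1,\infty}$ let $(A_0,L_\infty)^{\mathcal R}_{\theta,r,b,q,a}$ be the space of all $f\in A_0+L_\infty$ with $$\Big\|t^{-\frac1r}b(t)\,\big\|u^{-\theta-\frac1q}a(u)K(u,f;A_0,L_\infty)\big\|_{q,(t,\infty)}\Big\|_{r,(0,\infty)}<\infty ,$$ and let $L^{\mathcal R}_{p,r,b,q,a}$ and $(L)^{\mathcal R}_{p,r,b,q,a}$ be the spaces of all $f\in\mathcal M(\Omega,\mu)$ with, respectively, $$\Big\|t^{-\frac1r}b(t)\,\big\|u^{\frac1p-\frac1q}a(u)f^{*}(u)\big\|_{q,(t,\infty)}\Big\|_{r,(0,\infty)}<\infty,\qquad \Big\|t^{-\frac1r}b(t)\,\big\|u^{\frac1p-\frac1q}a(u)f^{**}(u)\big\|_{q,(t,\infty)}\Big\|_{r,(0,\infty)}<\infty ,$$ each space being equipped with the quasi-norm on the left-hand side. The grand Lorentz–Karamata spaces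 $L^{p),q,r}_b$ and $(L)^{p),q,r}_b$ are defined by the last two conditions with $a(u)$ omitted. Then $$(L_1,L_\infty)^{\mathcal R}_{\theta,r,b,q,a}=(L_{1,\infty},L_\infty)^{\mathcal R}_{\theta,r,b,q,a}=(L)^{\mathcal R}_{p,r,b,q,a}=L^{\mathcal R}_{p,r,b,q,a},$$ meaning that the spaces coincide as sets and their quasi-norms are equivalent, i.e. each is bounded on the space by a constant, independent of $f$, times any other. In particular, with $a\equiv1$, $$(L_1,L_\infty)^{\mathcal R}_{\theta,r,b,q,1}=(L_{1,\infty},L_\infty)^{\mathcal R}_{\theta,r,b,q,1}=(L)^{p),q,r}_{b}=L^{p),q,r}_{b}.$$ -/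

import Mathlib

open MeasureTheory Set
open scoped ENNReal NNReal

namespace LorentzKaramata

noncomputable section

/-- `μ` is non-atomic: every measurable set of positive measure has a measurable subset of
strictly smaller positive measure. (Stronger in general than vanishing on singletons.) -/
def IsNonatomic {Ω : Type*} [MeasurableSpace Ω] (μ : Measure Ω) : Prop :=
  ∀ A, MeasurableSet A → 0 < μ A → ∃ B ⊆ A, MeasurableSet B ∧ 0 < μ B ∧ μ B < μ A

/-- `f ≈ g` on `(0, ∞)`: each function is bounded by a positive constant times the other. -/
def EquivOn (f g : ℝ → ℝ) : Prop :=
  ∃ C : ℝ, 0 < C ∧ ∀ t, 0 < t → f t ≤ C * g t ∧ g t ≤ C * f t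

/-- Slowly varying functions on `(0, ∞)`; values outside `(0, ∞)` are irrelevant. -/
structure IsSlowlyVarying (b : ℝ → ℝ) : Prop where
  measurable : AEMeasurable b (volume.restrict (Ioi 0))
  pos : ∀ t, 0 < t → 0 < b t
  equiv_increasing : ∀ ε : ℝ, 0 < ε →
    ∃ g : ℝ → ℝ, MonotoneOn g (Ioi 0) ∧ EquivOn (fun t => t ^ ε * b t) g
  equiv_decreasing : ∀ ε : ℝ, 0 < ε →
    ∃ g : ℝ → ℝ, AntitoneOn g (Ioi 0) ∧ EquivOn (fun t => t ^ (-ε) * b t) g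

/-- The (quasi-)norm of `L_q` on the set `s ⊆ ℝ` with Lebesgue measure, `0 < q ≤ ∞`. -/
def qNorm (q : ℝ≥0∞) (s : Set ℝ) (g : ℝ → ℝ≥0∞) : ℝ≥0∞ :=
  eLpNorm g q (volume.restrict s)

/-- `1 / q` as a real number, with `1 / ∞ = 0`. -/
def recip (q : ℝ≥0∞) : ℝ := (q⁻¹).toReal

/-- The weight `t ^ α * b t`, `t > 0`. -/
def weight (α : ℝ) (b : ℝ → ℝ) (t : ℝ) : ℝ≥0∞ := ENNReal.ofReal (t ^ α * b t)

/-- `‖ t^{-1/r} b(t) ‖ u^{α-1/q} a(u) g(u) ‖_{q,(t,∞)} ‖_{r,(0,∞)}`. -/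
def rNorm (α : ℝ) (r : ℝ≥0∞) (b : ℝ → ℝ) (q : ℝ≥0∞) (a : ℝ → ℝ) (g : ℝ → ℝ≥0∞) : ℝ≥0∞ :=
  qNorm r (Ioi 0) fun t =>
    weight (-recip r) b t * qNorm q (Ioi t) fun u => weight (α - recip q) a u * g u

/-- A set of elements of `M` together with an extended-valued size functional, which is the
quasi-norm on that set. -/
structure QSpace (M : Type*) where
  carrier : Set M
  qnorm : M → ℝ≥0∞

namespace QSpace

variable {M : Type*}

/-- The space of all `f` with `N f < ∞`, with quasi-norm `N`. -/
def ofNorm (N : M → ℝ≥0∞) : QSpace M := ⟨{f | N f < ∞}, N⟩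

/-- Continuous embedding `X ⊂ Y`. -/
def Embeds (X Y : QSpace M) : Prop :=
  X.carrier ⊆ Y.carrier ∧ ∃ C : ℝ≥0, ∀ f ∈ X.carrier, Y.qnorm f ≤ C * X.qnorm f

/-- Equality of spaces with equivalence of quasi-norms. -/
def Identical (X Y : QSpace M) : Prop := Embeds X Y ∧ Embeds Y X

variable [Add M]

/-- The sum `A₀ + A₁`. -/
def sum (A₀ A₁ : QSpace M) : Set M :=
  {f | ∃ f₀ ∈ A₀.carrier, ∃ f₁ ∈ A₁.carrier, f = f₀ + f₁}

/-- Peetre's `K`-functional `K(t, f; A₀, A₁)`. -/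
def K (A₀ A₁ : QSpace M) (t : ℝ) (f : M) : ℝ≥0∞ :=
  ⨅ (f₀ ∈ A₀.carrier) (f₁ ∈ A₁.carrier) (_ : f = f₀ + f₁),
    A₀.qnorm f₀ + ENNReal.ofReal t * A₁.qnorm f₁

/-- The `𝓡`-limiting interpolation space of the couple `(A₀, A₁)`. -/
def limitingR (A₀ A₁ : QSpace M) (θ : ℝ) (r : ℝ≥0∞) (b : ℝ → ℝ) (q : ℝ≥0∞) (a : ℝ → ℝ) :
    QSpace M where
  carrier := {f | f ∈ sum A₀ A₁ ∧ rNorm (-θ) r b q a (fun u => K A₀ A₁ u f) < ∞}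
  qnorm f := rNorm (-θ) r b q a (fun u => K A₀ A₁ u f)

end QSpace

variable {Ω : Type*} [MeasurableSpace Ω] {μ : Measure Ω} {𝕜 : Type*} [RCLike 𝕜]

/-- The non-increasing rearrangement `f^*(t) = inf {λ ≥ 0 : μ {|f| > λ} ≤ t}`, `t > 0`. -/
def rearr (f : Ω →ₘ[μ] 𝕜) (t : ℝ) : ℝ≥0∞ :=
  sInf {l : ℝ≥0∞ | μ {x | l < ‖f x‖ₑ} ≤ ENNReal.ofReal t}

/-- The maximal function `f^{**}(t) = (1/t) ∫₀ᵗ f^*(u) du`, `t > 0`. -/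
def maxRearr (f : Ω →ₘ[μ] 𝕜) (t : ℝ) : ℝ≥0∞ :=
  (∫⁻ u in Ioo 0 t, rearr f u) / ENNReal.ofReal t

variable (μ 𝕜)

/-- The Lebesgue space `L_p` as a space of classes of measurable functions. -/
def lebesgue (p : ℝ≥0∞) : QSpace (Ω →ₘ[μ] 𝕜) := .ofNorm fun f => eLpNorm f p μ

/-- The Lorentz–Karamata space `L_{p,q;a}`, defined through `f^*`. -/
def lorentzKaramata (p q : ℝ≥0∞) (a : ℝ → ℝ) : QSpace (Ω →ₘ[μ] 𝕜) :=
  .ofNorm fun f => qNorm q (Ioi 0) fun t => weight (recip p - recip q) a t * rearr f t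

/-- The Lorentz space `L_{p,q}`; in particular `L_{1,∞}`. -/
def lorentz (p q : ℝ≥0∞) : QSpace (Ω →ₘ[μ] 𝕜) := lorentzKaramata μ 𝕜 p q fun _ => 1

/-- The `𝓡` Lorentz–Karamata space `L^𝓡_{p,r,b,q,a}`, defined through `f^*`. -/
def starR (p r : ℝ≥0∞) (b : ℝ → ℝ) (q : ℝ≥0∞) (a : ℝ → ℝ) : QSpace (Ω →ₘ[μ] 𝕜) :=
  .ofNorm fun f => rNorm (recip p) r b q a (rearr f)

/-- The `𝓡` Lorentz–Karamata space `(L)^𝓡_{p,r,b,q,a}`, defined through `f^{**}`. -/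
def maxR (p r : ℝ≥0∞) (b : ℝ → ℝ) (q : ℝ≥0∞) (a : ℝ → ℝ) : QSpace (Ω →ₘ[μ] 𝕜) :=
  .ofNorm fun f => rNorm (recip p) r b q a (maxRearr f)

/-- The grand Lorentz–Karamata space `L^{p),q,r}_b`, defined through `f^*`. -/
def grandStar (p q r : ℝ≥0∞) (b : ℝ → ℝ) : QSpace (Ω →ₘ[μ] 𝕜) :=
  .ofNorm fun f => qNorm r (Ioi 0) fun t => weight (-recip r) b t *
    qNorm q (Ioi t) fun u => ENNReal.ofReal (u ^ (recip p - recip q)) * rearr f u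

/-- The grand Lorentz–Karamata space `(L)^{p),q,r}_b`, defined through `f^{**}`. -/
def grandMax (p q r : ℝ≥0∞) (b : ℝ → ℝ) : QSpace (Ω →ₘ[μ] 𝕜) :=
  .ofNorm fun f => qNorm r (Ioi 0) fun t => weight (-recip r) b t *
    qNorm q (Ioi t) fun u => ENNReal.ofReal (u ^ (recip p - recip q)) * maxRearr f u

end

end LorentzKaramata

/-!
The four quasi-norms dominate one another in a cycle. For each `t`, Chebyshev's inequality gives
`K(t, f; L_{1,∞}, L_∞) ≤ K(t, f; L_1, L_∞)`, any splitting `f = f₀ + f₁` gives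
`t f^*(t) ≤ 2 K(t, f; L_{1,∞}, L_∞)`, and splitting `f` at the height `f^*(t)` gives
`K(t, f; L_1, L_∞) ≤ 2 t f^{**}(t)`. The cycle is closed by a Hardy inequality bounding the norm of
`f^{**}` by that of `f^*`. Since `f^*` is non-increasing, `f^{**}(u)` is at most
`∑ σ^k f^*(σ^{k+1} u)` for every `0 < σ < 1`. Dilating the argument by `σ` costs a factor
`σ^{-(1-θ)-ε}` with `ε < θ`, so for `σ` small the series of quasi-norms converges geometrically,
even against the powers of the quasi-triangle constants.
-/

namespace LorentzKaramata

section Weight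

/-- Positive measurable functions on `(0, ∞)` of upper order at most `γ`, that is,
`b (l * s) ≤ C * l ^ γ * b s` for `l ≥ 1`; the infimum of such `γ` is the upper Matuszewska index.
A slowly varying function has upper order at most `ε` for every `ε > 0`. -/
structure HasUpperOrder (γ : ℝ) (b : ℝ → ℝ) : Prop where
  aemeasurable : AEMeasurable b (volume.restrict (Ioi 0))
  pos : ∀ t, 0 < t → 0 < b t
  exists_le_mul : ∃ C : ℝ, ∀ s t, 0 < s → s ≤ t → b t ≤ C * (t / s) ^ γ * b s

theorem IsSlowlyVarying.hasUpperOrder {b : ℝ → ℝ} (hb : IsSlowlyVarying b) {ε : ℝ} (hε : 0 < ε) :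
    HasUpperOrder ε b := by
  refine ⟨hb.measurable, hb.pos, ?_⟩
  obtain ⟨g, hg, C, hC, hbg⟩ := hb.equiv_decreasing ε hε
  refine ⟨C * C, fun s t hs hst => ?_⟩
  have ht : 0 < t := hs.trans_le hst
  have quasi_decreasing : t ^ (-ε) * b t ≤ C * (C * (s ^ (-ε) * b s)) :=
    calc t ^ (-ε) * b t ≤ C * g t := (hbg t ht).1
      _ ≤ C * g s := by gcongr; exact hg hs ht hst
      _ ≤ C * (C * (s ^ (-ε) * b s)) := by gcongr; exact (hbg s hs).2
  calc b t = t ^ ε * (t ^ (-ε) * b t) := by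
        rw [← mul_assoc, ← Real.rpow_add ht, add_neg_cancel, Real.rpow_zero, one_mul]
    _ ≤ t ^ ε * (C * (C * (s ^ (-ε) * b s))) := by gcongr
    _ = C * C * (t / s) ^ ε * b s := by
        rw [Real.div_rpow ht.le hs.le, Real.rpow_neg hs.le]
        ring

theorem hasUpperOrder_one {γ : ℝ} (hγ : 0 ≤ γ) : HasUpperOrder γ fun _ => 1 where
  aemeasurable := aemeasurable_const
  pos _ _ := one_pos
  exists_le_mul := ⟨1, fun s t hs hst => by
    simpa using Real.one_le_rpow ((one_le_div hs).2 hst) hγ⟩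

theorem aemeasurable_weight (α : ℝ) {b : ℝ → ℝ} (hb : AEMeasurable b (volume.restrict (Ioi 0))) :
    AEMeasurable (weight α b) (volume.restrict (Ioi 0)) :=
  ((Measurable.aemeasurable (by fun_prop)).mul hb).ennreal_ofReal

theorem weight_pos (α : ℝ) {b : ℝ → ℝ} {t : ℝ} (ht : 0 < t) (hb : 0 < b t) :
    0 < weight α b t :=
  ENNReal.ofReal_pos.2 (mul_pos (Real.rpow_pos_of_pos ht _) hb)

theorem weight_mul_ofReal (α : ℝ) (b : ℝ → ℝ) {t : ℝ} (ht : 0 < t) :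
    weight α b t * ENNReal.ofReal t = weight (α + 1) b t := by
  rw [weight, weight, ← ENNReal.ofReal_mul' ht.le, Real.rpow_add_one ht.ne', mul_right_comm]

theorem HasUpperOrder.exists_weight_le {γ : ℝ} {b : ℝ → ℝ} (hb : HasUpperOrder γ b) :
    ∃ C : ℝ≥0, ∀ α σ t : ℝ, 0 < σ → σ ≤ 1 → 0 < t →
      weight α b t ≤ C * ENNReal.ofReal (σ ^ (-α - γ)) * weight α b (σ * t) := by
  obtain ⟨C, hC⟩ := hb.exists_le_mul
  refine ⟨C.toNNReal, fun α σ t hσ hσ1 ht => ?_⟩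
  have hσt : 0 < σ * t := mul_pos hσ ht
  have hbt : b t ≤ C * σ ^ (-γ) * b (σ * t) := by
    have hratio : t / (σ * t) = σ⁻¹ := by field_simp
    simpa only [hratio, Real.inv_rpow hσ.le, Real.rpow_neg hσ.le] using
      hC (σ * t) t hσt (mul_le_of_le_one_left ht.le hσ1)
  rw [← ENNReal.ofReal, ← ENNReal.ofReal_mul' (by positivity), weight, weight,
    ← ENNReal.ofReal_mul' (mul_nonneg (by positivity) (hb.pos _ hσt).le)]
  refine ENNReal.ofReal_le_ofReal ?_
  calc t ^ α * b t ≤ t ^ α * (C * σ ^ (-γ) * b (σ * t)) := by gcongr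
    _ = C * σ ^ (-α - γ) * ((σ * t) ^ α * b (σ * t)) := by
        rw [Real.mul_rpow hσ.le ht.le, sub_eq_add_neg, Real.rpow_add hσ, Real.rpow_neg hσ.le α]
        field_simp

end Weight

section CountableSums

variable {X : Type*} [MeasurableSpace X] {ν : Measure X}

theorem eLpNorm_iSup_le {q : ℝ≥0∞} {f : ℕ → X → ℝ≥0∞} (hf : ∀ n, AEMeasurable (f n) ν)
    (hmono : Monotone f) : eLpNorm (fun x => ⨆ n, f n x) q ν ≤ ⨆ n, eLpNorm (f n) q ν := by
  rcases eq_or_ne q 0 with rfl | hq0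
  · simp
  rcases eq_or_ne q ∞ with rfl | hq
  · simp only [eLpNorm_exponent_top, eLpNormEssSup, enorm_eq_self]
    refine essSup_le_of_ae_le _ ?_
    filter_upwards [ae_all_iff.2 fun n => ENNReal.ae_le_essSup (f n)] with x hx
    exact iSup_mono hx
  · have hq' : 0 < q.toReal := ENNReal.toReal_pos hq0 hq
    have iSup_rpow : ∀ x, (⨆ n, f n x) ^ q.toReal = ⨆ n, f n x ^ q.toReal := fun x =>
      (ENNReal.orderIsoRpow _ hq').map_iSup _
    simp only [eLpNorm_eq_lintegral_rpow_enorm_toReal hq0 hq, enorm_eq_self, iSup_rpow]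
    rw [lintegral_iSup' (fun n => (hf n).pow_const _)
      (.of_forall fun x m n hmn => ENNReal.rpow_le_rpow (hmono hmn x) hq'.le)]
    exact ((ENNReal.orderIsoRpow _ (one_div_pos.2 hq')).map_iSup _).le

theorem eLpNorm_sum_range_le (q : ℝ≥0∞) (n : ℕ) {f : ℕ → X → ℝ≥0∞}
    (hf : ∀ k, AEMeasurable (f k) ν) :
    eLpNorm (fun x => ∑ k ∈ Finset.range n, f k x) q ν ≤
      ∑ k ∈ Finset.range n, ENNReal.LpAddConst q ^ (k + 1) * eLpNorm (f k) q ν := by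
  induction n generalizing f with
  | zero => simp
  | succ n ih =>
    simp only [Finset.sum_range_succ', add_comm _ (f 0 _)]
    calc eLpNorm (fun x => f 0 x + ∑ k ∈ Finset.range n, f (k + 1) x) q ν
        ≤ ENNReal.LpAddConst q * (eLpNorm (f 0) q ν +
            eLpNorm (fun x => ∑ k ∈ Finset.range n, f (k + 1) x) q ν) :=
          eLpNorm_add_le' (hf 0).aestronglyMeasurable
            (Finset.aemeasurable_fun_sum _ fun k _ => hf (k + 1)).aestronglyMeasurable q
      _ ≤ ENNReal.LpAddConst q * (eLpNorm (f 0) q ν + ∑ k ∈ Finset.range n,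
            ENNReal.LpAddConst q ^ (k + 1) * eLpNorm (f (k + 1)) q ν) := by
          gcongr
          exact ih fun k => hf (k + 1)
      _ = _ := by
          rw [mul_add, add_comm, Finset.mul_sum]
          simp only [← mul_assoc, ← pow_succ', zero_add, pow_one]

theorem eLpNorm_tsum_le (q : ℝ≥0∞) {f : ℕ → X → ℝ≥0∞} (hf : ∀ k, AEMeasurable (f k) ν) :
    eLpNorm (fun x => ∑' k, f k x) q ν ≤
      ∑' k, ENNReal.LpAddConst q ^ (k + 1) * eLpNorm (f k) q ν := by
  simp only [ENNReal.tsum_eq_iSup_nat]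
  refine (eLpNorm_iSup_le (fun n => Finset.aemeasurable_fun_sum _ fun k _ => hf k)
    fun m n hmn x => Finset.sum_le_sum_of_subset (Finset.range_subset_range.2 hmn)).trans ?_
  exact iSup_mono fun n => eLpNorm_sum_range_le q n hf

end CountableSums

section QNorm

variable {q : ℝ≥0∞} {s : Set ℝ} {g h : ℝ → ℝ≥0∞}

theorem qNorm_le_mul (hs : MeasurableSet s) {c : ℝ≥0∞} (hc : c ≠ ∞)
    (hgh : ∀ u ∈ s, g u ≤ c * h u) : qNorm q s g ≤ c * qNorm q s h := by
  lift c to ℝ≥0 using hc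
  exact eLpNorm_le_mul_eLpNorm_of_ae_le_mul' (ae_restrict_of_forall_mem hs hgh) q

theorem qNorm_mono (hs : MeasurableSet s) (hgh : ∀ u ∈ s, g u ≤ h u) :
    qNorm q s g ≤ qNorm q s h :=
  eLpNorm_mono_enorm_ae (ae_restrict_of_forall_mem hs hgh)

theorem qNorm_congr (hs : MeasurableSet s) (hgh : ∀ u ∈ s, g u = h u) :
    qNorm q s g = qNorm q s h :=
  eLpNorm_congr_ae (ae_restrict_of_forall_mem hs hgh)

theorem antitone_qNorm_Ioi (q : ℝ≥0∞) (g : ℝ → ℝ≥0∞) : Antitone fun t => qNorm q (Ioi t) g :=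
  fun _ _ hst => eLpNorm_mono_measure g (Measure.restrict_mono (Ioi_subset_Ioi hst) le_rfl)

theorem qNorm_comp_mul_left (q : ℝ≥0∞) {σ : ℝ} (hσ : 0 < σ) (s : Set ℝ) (g : ℝ → ℝ≥0∞) :
    qNorm q ((σ * ·) ⁻¹' s) (fun u => g (σ * u)) =
      ENNReal.ofReal (σ ^ (-recip q)) * qNorm q s g := by
  have hemb : MeasurableEmbedding (σ * · : ℝ → ℝ) := measurableEmbedding_mulLeft₀ hσ.ne'
  have hmap : (volume.restrict ((σ * ·) ⁻¹' s)).map (σ * ·) =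
      ENNReal.ofReal σ⁻¹ • volume.restrict s := by
    rw [← hemb.restrict_map, Real.map_volume_mul_left hσ.ne', abs_of_pos (inv_pos.2 hσ),
      Measure.restrict_smul]
  calc qNorm q ((σ * ·) ⁻¹' s) (fun u => g (σ * u))
      = eLpNorm g q ((volume.restrict ((σ * ·) ⁻¹' s)).map (σ * ·)) :=
        hemb.eLpNorm_map_measure.symm
    _ = ENNReal.ofReal (σ ^ (-recip q)) * qNorm q s g := by
        rw [hmap, eLpNorm_smul_measure_of_ne_zero (by simpa using hσ), smul_eq_mul, one_div,
          ENNReal.ofReal_rpow_of_pos (inv_pos.2 hσ), Real.inv_rpow hσ.le, ← Real.rpow_neg hσ.le,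
          recip, qNorm]

theorem qNorm_Ioi_comp_mul_left (q : ℝ≥0∞) {σ : ℝ} (hσ : 0 < σ) (t : ℝ) (g : ℝ → ℝ≥0∞) :
    qNorm q (Ioi t) (fun u => g (σ * u)) =
      ENNReal.ofReal (σ ^ (-recip q)) * qNorm q (Ioi (σ * t)) g := by
  rw [← qNorm_comp_mul_left q hσ, preimage_const_mul_Ioi₀ _ hσ, mul_div_cancel_left₀ _ hσ.ne']

theorem qNorm_Ioi_top (hq : 0 < q) (t : ℝ) : qNorm q (Ioi t) (fun _ => ∞) = ∞ := by
  rw [qNorm, eLpNorm_const _ hq.ne' (by simp)]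
  exact ENNReal.top_mul (by simp)

end QNorm

section RNorm

variable {α : ℝ} {r q : ℝ≥0∞} {a b : ℝ → ℝ}

theorem rNorm_le_mul {g h : ℝ → ℝ≥0∞} {c : ℝ≥0∞} (hc : c ≠ ∞)
    (hgh : ∀ u, 0 < u → g u ≤ c * h u) : rNorm α r b q a g ≤ c * rNorm α r b q a h := by
  refine qNorm_le_mul measurableSet_Ioi hc fun t ht => ?_
  rw [mul_left_comm]
  refine mul_le_mul_right (qNorm_le_mul measurableSet_Ioi hc fun u hu => ?_) _
  rw [mul_left_comm]
  exact mul_le_mul_right (hgh u (lt_trans ht hu)) _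

theorem rNorm_ofReal_mul (g : ℝ → ℝ≥0∞) :
    rNorm α r b q a (fun u => ENNReal.ofReal u * g u) = rNorm (α + 1) r b q a g := by
  refine qNorm_congr measurableSet_Ioi fun t ht => ?_
  congr 1
  refine qNorm_congr measurableSet_Ioi fun u hu => ?_
  rw [← mul_assoc, weight_mul_ofReal _ _ (lt_trans ht hu), sub_add_eq_add_sub]

theorem rNorm_tsum_le (ha : AEMeasurable a (volume.restrict (Ioi 0)))
    (hb : AEMeasurable b (volume.restrict (Ioi 0))) {f : ℕ → ℝ → ℝ≥0∞}
    (hf : ∀ k, AEMeasurable (f k) (volume.restrict (Ioi 0))) :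
    rNorm α r b q a (fun u => ∑' k, f k u) ≤
      ∑' k, (ENNReal.LpAddConst q * ENNReal.LpAddConst r) ^ (k + 1) * rNorm α r b q a (f k) := by
  set I : ℕ → ℝ → ℝ≥0∞ := fun k t => qNorm q (Ioi t) fun u => weight (α - recip q) a u * f k u
  set F : ℕ → ℝ → ℝ≥0∞ := fun k t =>
    ENNReal.LpAddConst q ^ (k + 1) * (weight (-recip r) b t * I k t)
  have inner : ∀ t ∈ Ioi (0 : ℝ), weight (-recip r) b t *
      (qNorm q (Ioi t) fun u => weight (α - recip q) a u * ∑' k, f k u) ≤ ∑' k, F k t := by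
    intro t ht
    have pull_out : ∑' k, F k t =
        weight (-recip r) b t * ∑' k, ENNReal.LpAddConst q ^ (k + 1) * I k t := by
      rw [← ENNReal.tsum_mul_left]
      exact tsum_congr fun k => mul_left_comm _ _ _
    have push_in : (fun u => weight (α - recip q) a u * ∑' k, f k u) =
        fun u => ∑' k, weight (α - recip q) a u * f k u :=
      funext fun u => ENNReal.tsum_mul_left.symm
    rw [pull_out, push_in]
    refine mul_le_mul_right (eLpNorm_tsum_le q fun k => ?_) _
    exact ((aemeasurable_weight _ ha).mul (hf k)).mono_measure
      (Measure.restrict_mono (Ioi_subset_Ioi (le_of_lt ht)) le_rfl)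
  have measurable_F : ∀ k, AEMeasurable (F k) (volume.restrict (Ioi 0)) := fun k =>
    ((aemeasurable_weight _ hb).mul (antitone_qNorm_Ioi q _).measurable.aemeasurable).const_mul _
  refine (qNorm_mono measurableSet_Ioi inner).trans ((eLpNorm_tsum_le r measurable_F).trans ?_)
  refine ENNReal.tsum_le_tsum fun k => ?_
  rw [mul_pow, mul_comm (ENNReal.LpAddConst q ^ _), mul_assoc]
  exact mul_le_mul_right (qNorm_le_mul measurableSet_Ioi
    (ENNReal.pow_ne_top (ENNReal.LpAddConst_lt_top q).ne) fun t _ => le_rfl) _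

theorem exists_rNorm_comp_mul_left_le (α : ℝ) (r q : ℝ≥0∞) {γ β : ℝ} (ha : HasUpperOrder γ a)
    (hb : HasUpperOrder β b) :
    ∃ C : ℝ≥0, ∀ σ : ℝ, 0 < σ → σ ≤ 1 → ∀ g : ℝ → ℝ≥0∞,
      rNorm α r b q a (fun u => g (σ * u)) ≤
        C * ENNReal.ofReal (σ ^ (-α - γ - β)) * rNorm α r b q a g := by
  obtain ⟨A, hA⟩ := ha.exists_weight_le
  obtain ⟨B, hB⟩ := hb.exists_weight_le
  refine ⟨A * B, fun σ hσ hσ1 g => ?_⟩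
  set I : ℝ → ℝ≥0∞ := fun t => qNorm q (Ioi t) fun u => weight (α - recip q) a u * g u
  have inner : ∀ t, 0 < t → (qNorm q (Ioi t) fun u => weight (α - recip q) a u * g (σ * u)) ≤
      A * ENNReal.ofReal (σ ^ (-α - γ)) * I (σ * t) := fun t ht =>
    calc (qNorm q (Ioi t) fun u => weight (α - recip q) a u * g (σ * u))
        ≤ A * ENNReal.ofReal (σ ^ (-(α - recip q) - γ)) *
            qNorm q (Ioi t) fun u => weight (α - recip q) a (σ * u) * g (σ * u) := by
          refine qNorm_le_mul measurableSet_Ioi (by finiteness) fun u hu => ?_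
          rw [← mul_assoc]
          exact mul_le_mul_left (hA _ σ u hσ hσ1 (lt_trans ht hu)) _
      _ = A * ENNReal.ofReal (σ ^ (-α - γ)) * I (σ * t) := by
          rw [qNorm_Ioi_comp_mul_left q hσ t fun u => weight (α - recip q) a u * g u, ← mul_assoc,
            mul_assoc (A : ℝ≥0∞), ← ENNReal.ofReal_mul (by positivity), ← Real.rpow_add hσ,
            show -(α - recip q) - γ + -recip q = -α - γ by ring]
  calc rNorm α r b q a (fun u => g (σ * u))
      ≤ B * ENNReal.ofReal (σ ^ (-(-recip r) - β)) * (A * ENNReal.ofReal (σ ^ (-α - γ))) *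
          qNorm r (Ioi 0) fun t => weight (-recip r) b (σ * t) * I (σ * t) := by
        refine qNorm_le_mul measurableSet_Ioi (by finiteness) fun t ht => ?_
        rw [mul_mul_mul_comm]
        exact mul_le_mul' (hB _ σ t hσ hσ1 ht) (inner t ht)
    _ = (A * B : ℝ≥0) * (ENNReal.ofReal (σ ^ (-(-recip r) - β)) * ENNReal.ofReal (σ ^ (-α - γ)) *
          ENNReal.ofReal (σ ^ (-recip r))) * rNorm α r b q a g := by
        rw [qNorm_Ioi_comp_mul_left r hσ 0 fun t => weight (-recip r) b t * I t, mul_zero,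
          ENNReal.coe_mul, rNorm]
        ring
    _ = (A * B : ℝ≥0) * ENNReal.ofReal (σ ^ (-α - γ - β)) * rNorm α r b q a g := by
        rw [← ENNReal.ofReal_mul (by positivity), ← ENNReal.ofReal_mul (by positivity),
          ← Real.rpow_add hσ, ← Real.rpow_add hσ]
        ring_nf

theorem exists_lt_top_of_rNorm_lt_top (hq : 0 < q) (hr : 0 < r) (ha : ∀ t, 0 < t → 0 < a t)
    (hb : ∀ t, 0 < t → 0 < b t) {g : ℝ → ℝ≥0∞} (hg : rNorm α r b q a g < ∞) :
    ∃ u, 0 < u ∧ g u < ∞ := by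
  by_contra! htop
  have inner : ∀ t, 0 < t → (qNorm q (Ioi t) fun u => weight (α - recip q) a u * g u) = ∞ := by
    intro t ht
    rw [← qNorm_Ioi_top hq t]
    refine qNorm_congr measurableSet_Ioi fun u hu => ?_
    have hu0 : 0 < u := lt_trans ht hu
    rw [top_le_iff.1 (htop u hu0), ENNReal.mul_top (weight_pos _ hu0 (ha u hu0)).ne']
  refine hg.ne ((qNorm_congr measurableSet_Ioi fun t ht => ?_).trans (qNorm_Ioi_top hr 0))
  rw [inner t ht, ENNReal.mul_top (weight_pos _ ht (hb t ht)).ne']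

end RNorm

section Hardy

/-- The mean of `g` over `(0, t)`, i.e. the Hardy averaging operator; `f^{**}` is the mean of
`f^*`. -/
noncomputable def mean (g : ℝ → ℝ≥0∞) (t : ℝ) : ℝ≥0∞ :=
  (∫⁻ u in Ioo 0 t, g u) / ENNReal.ofReal t

theorem ofReal_mul_mean (g : ℝ → ℝ≥0∞) {t : ℝ} (ht : 0 < t) :
    ENNReal.ofReal t * mean g t = ∫⁻ u in Ioo 0 t, g u :=
  ENNReal.mul_div_cancel (by simpa using ht) ENNReal.ofReal_ne_top

theorem Ioo_zero_subset_iUnion_Ioc {σ : ℝ} (h0 : 0 < σ) (h1 : σ < 1) {u : ℝ} (hu : 0 < u) :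
    Ioo 0 u ⊆ ⋃ k : ℕ, Ioc (σ ^ (k + 1) * u) (σ ^ k * u) := fun v hv => by
  obtain ⟨k, hk, hk'⟩ := exists_nat_pow_near_of_lt_one (x := v / u) (div_pos hv.1 hu)
    ((div_le_one hu).2 hv.2.le) h0 h1
  exact mem_iUnion.2 ⟨k, (lt_div_iff₀ hu).1 hk, (div_le_iff₀ hu).1 hk'⟩

theorem mean_le_tsum {g : ℝ → ℝ≥0∞} (hg : Antitone g) {σ : ℝ} (h0 : 0 < σ) (h1 : σ < 1) {u : ℝ}
    (hu : 0 < u) : mean g u ≤ ∑' k : ℕ, ENNReal.ofReal σ ^ k * g (σ ^ (k + 1) * u) := by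
  refine ENNReal.div_le_of_le_mul ?_
  calc ∫⁻ v in Ioo 0 u, g v
      ≤ ∫⁻ v in ⋃ k : ℕ, Ioc (σ ^ (k + 1) * u) (σ ^ k * u), g v :=
        lintegral_mono_set (Ioo_zero_subset_iUnion_Ioc h0 h1 hu)
    _ ≤ ∑' k : ℕ, ∫⁻ v in Ioc (σ ^ (k + 1) * u) (σ ^ k * u), g v := lintegral_iUnion_le _ _
    _ ≤ ∑' k : ℕ, g (σ ^ (k + 1) * u) * ENNReal.ofReal (σ ^ k * u - σ ^ (k + 1) * u) :=
        ENNReal.tsum_le_tsum fun k => by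
          rw [← Real.volume_Ioc, ← setLIntegral_const]
          exact setLIntegral_mono' measurableSet_Ioc fun v hv => hg hv.1.le
    _ ≤ ∑' k : ℕ, ENNReal.ofReal σ ^ k * g (σ ^ (k + 1) * u) * ENNReal.ofReal u := by
        refine ENNReal.tsum_le_tsum fun k => ?_
        rw [mul_right_comm, mul_comm, ← ENNReal.ofReal_pow h0.le, ← ENNReal.ofReal_mul' hu.le]
        gcongr
        exact sub_le_self _ (by positivity)
    _ = (∑' k : ℕ, ENNReal.ofReal σ ^ k * g (σ ^ (k + 1) * u)) * ENNReal.ofReal u :=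
        ENNReal.tsum_mul_right

theorem exists_mul_ofReal_rpow_lt_one {D : ℝ≥0∞} (hD : D ≠ ∞) {η : ℝ} (hη : 0 < η) :
    ∃ σ : ℝ, 0 < σ ∧ σ < 1 ∧ D * ENNReal.ofReal (σ ^ η) < 1 := by
  have hlim : Filter.Tendsto (fun σ : ℝ => D * ENNReal.ofReal (σ ^ η))
      (nhdsWithin 0 (Ioi 0)) (nhds 0) := by
    have hcont : Continuous fun σ : ℝ => D * ENNReal.ofReal (σ ^ η) :=
      (ENNReal.continuous_const_mul hD).comp
        (ENNReal.continuous_ofReal.comp (Real.continuous_rpow_const hη.le))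
    simpa [Real.zero_rpow hη.ne'] using (hcont.tendsto 0).mono_left nhdsWithin_le_nhds
  obtain ⟨σ, hσ, hσ0, hσ1⟩ :=
    ((hlim.eventually_lt_const one_pos).and (Ioo_mem_nhdsGT one_pos)).exists
  exact ⟨σ, hσ0, hσ1, hσ⟩

theorem exists_rNorm_mean_le {α γ β : ℝ} {a b : ℝ → ℝ} (r q : ℝ≥0∞) (ha : HasUpperOrder γ a)
    (hb : HasUpperOrder β b) (hα : α + γ + β < 1) :
    ∃ C : ℝ≥0, ∀ g : ℝ → ℝ≥0∞, Antitone g →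
      rNorm α r b q a (mean g) ≤ C * rNorm α r b q a g := by
  obtain ⟨C, hC⟩ := exists_rNorm_comp_mul_left_le α r q ha hb
  set D : ℝ≥0∞ := ENNReal.LpAddConst q * ENNReal.LpAddConst r
  have hD : D ≠ ∞ :=
    ENNReal.mul_ne_top (ENNReal.LpAddConst_lt_top q).ne (ENNReal.LpAddConst_lt_top r).ne
  obtain ⟨σ, h0, h1, hσ⟩ := exists_mul_ofReal_rpow_lt_one hD (η := -α - γ - β + 1) (by linarith)
  set y : ℝ≥0∞ := ENNReal.ofReal (σ ^ (-α - γ - β)) with hy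
  have ratio_lt_one : D * (y * ENNReal.ofReal σ) < 1 := by
    rwa [hy, ← ENNReal.ofReal_mul (by positivity), ← Real.rpow_add_one h0.ne']
  have hfin : D * C * y * (1 - D * (y * ENNReal.ofReal σ))⁻¹ ≠ ∞ :=
    ENNReal.mul_ne_top (by finiteness) (ENNReal.inv_ne_top.2 (tsub_pos_of_lt ratio_lt_one).ne')
  refine ⟨(D * C * y * (1 - D * (y * ENNReal.ofReal σ))⁻¹).toNNReal, fun g hg => ?_⟩
  have dilate_le (k : ℕ) : rNorm α r b q a (fun u => ENNReal.ofReal σ ^ k * g (σ ^ (k + 1) * u)) ≤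
      ENNReal.ofReal σ ^ k * (C * y ^ (k + 1) * rNorm α r b q a g) := by
    refine (rNorm_le_mul (by finiteness) fun u _ => le_rfl).trans (mul_le_mul_right ?_ _)
    rw [hy, ← ENNReal.ofReal_pow (by positivity), Real.rpow_pow_comm h0.le]
    exact hC _ (by positivity) (pow_le_one₀ h0.le h1.le) g
  calc rNorm α r b q a (mean g)
      ≤ rNorm α r b q a fun u => ∑' k : ℕ, ENNReal.ofReal σ ^ k * g (σ ^ (k + 1) * u) := by
        simpa using rNorm_le_mul ENNReal.one_ne_top fun u hu =>
          (mean_le_tsum hg h0 h1 hu).trans_eq (one_mul _).symm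
    _ ≤ ∑' k : ℕ, D ^ (k + 1) *
          rNorm α r b q a fun u => ENNReal.ofReal σ ^ k * g (σ ^ (k + 1) * u) :=
        rNorm_tsum_le ha.aemeasurable hb.aemeasurable fun k =>
          ((hg.measurable.comp (measurable_const_mul _)).const_mul _).aemeasurable
    _ ≤ ∑' k : ℕ, D ^ (k + 1) * (ENNReal.ofReal σ ^ k * (C * y ^ (k + 1) * rNorm α r b q a g)) :=
        ENNReal.tsum_le_tsum fun k => mul_le_mul_right (dilate_le k) _
    _ = ∑' k : ℕ, D * C * y * (D * (y * ENNReal.ofReal σ)) ^ k * rNorm α r b q a g :=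
        tsum_congr fun k => by ring
    _ = _ := by
        rw [ENNReal.tsum_mul_right, ENNReal.tsum_mul_left, ENNReal.tsum_geometric,
          ENNReal.coe_toNNReal hfin]

end Hardy

section LayerCake

theorem volume_Ioo_inter_ofReal_lt (t : ℝ) (c : ℝ≥0∞) :
    volume (Ioo 0 t ∩ {u | ENNReal.ofReal u < c}) = min (ENNReal.ofReal t) c := by
  rcases eq_or_ne c ∞ with rfl | hc
  · simp
  have hset : Ioo 0 t ∩ {u | ENNReal.ofReal u < c} = Ioo 0 (min t c.toReal) := by
    ext u
    simp only [mem_inter_iff, mem_Ioo, mem_ofPred_eq, lt_min_iff, and_assoc]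
    exact and_congr_right fun hu =>
      and_congr_right fun _ => ENNReal.ofReal_lt_iff_lt_toReal hu.le hc
  rw [hset, Real.volume_Ioo, sub_zero, ENNReal.ofReal_min, ENNReal.ofReal_toReal hc]

/-- Unlike `lintegral_eq_lintegral_meas_lt`, this allows the value `∞`. -/
theorem lintegral_eq_lintegral_measure_ofReal_lt {X : Type*} [MeasurableSpace X] (ν : Measure X)
    {h : X → ℝ≥0∞} (hh : AEMeasurable h ν) :
    ∫⁻ x, h x ∂ν = ∫⁻ s in Ioi (0 : ℝ), ν {x | ENNReal.ofReal s < h x} := by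
  by_cases hfin : ∀ᵐ x ∂ν, h x ≠ ∞
  · have htoReal : ∀ᵐ x ∂ν, ENNReal.ofReal (h x).toReal = h x :=
      hfin.mono fun x hx => ENNReal.ofReal_toReal hx
    rw [← lintegral_congr_ae htoReal, lintegral_eq_lintegral_meas_lt ν
      (.of_forall fun x => ENNReal.toReal_nonneg) hh.ennreal_toReal]
    refine setLIntegral_congr_fun measurableSet_Ioi fun s hs => measure_congr ?_
    filter_upwards [hfin] with x hx
    exact propext (ENNReal.ofReal_lt_iff_lt_toReal (le_of_lt hs) hx).symm
  · have htop : ν {x | h x = ∞} ≠ 0 := fun h0 => hfin (measure_eq_zero_iff_ae_notMem.1 h0)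
    have hleft : ∫⁻ x, h x ∂ν = ∞ := by
      by_contra hne
      exact hfin ((ae_lt_top' hh hne).mono fun x hx => hx.ne)
    rw [hleft, eq_comm, ← top_le_iff]
    calc ∞ = ∫⁻ _ in Ioi (0 : ℝ), ν {x | h x = ∞} := by simp [ENNReal.mul_top htop]
      _ ≤ ∫⁻ s in Ioi (0 : ℝ), ν {x | ENNReal.ofReal s < h x} :=
          lintegral_mono fun s => measure_mono fun x hx =>
            ENNReal.ofReal_lt_top.trans_eq (Eq.symm hx)

end LayerCake

section Rearrangement

variable {Ω : Type*} [MeasurableSpace Ω] {μ : Measure Ω} {𝕜 : Type*} [RCLike 𝕜]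

theorem antitone_rearr (f : Ω →ₘ[μ] 𝕜) : Antitone (rearr f) := fun _ _ hst =>
  sInf_le_sInf fun _ hl => le_trans hl (ENNReal.ofReal_le_ofReal hst)

theorem measure_rearr_lt_le (f : Ω →ₘ[μ] 𝕜) (t : ℝ) :
    μ {x | rearr f t < ‖f x‖ₑ} ≤ ENNReal.ofReal t := by
  set S : Set ℝ≥0∞ := {l | μ {x | l < ‖f x‖ₑ} ≤ ENNReal.ofReal t}
  obtain ⟨l, hl, hlim, hmem⟩ := exists_seq_tendsto_sInf (S := S) ⟨∞, by simp [S]⟩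
    (OrderBot.bddBelow S)
  have hmono : Monotone fun n => {x | l n < ‖f x‖ₑ} := fun m n hmn x hx => (hl hmn).trans_lt hx
  calc μ {x | rearr f t < ‖f x‖ₑ} ≤ μ (⋃ n, {x | l n < ‖f x‖ₑ}) :=
        measure_mono fun x hx => mem_iUnion.2 (hlim.eventually_lt_const hx).exists
    _ = ⨆ n, μ {x | l n < ‖f x‖ₑ} := hmono.measure_iUnion
    _ ≤ ENNReal.ofReal t := iSup_le hmem

theorem rearr_le_iff (f : Ω →ₘ[μ] 𝕜) (t : ℝ) (l : ℝ≥0∞) :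
    rearr f t ≤ l ↔ μ {x | l < ‖f x‖ₑ} ≤ ENNReal.ofReal t :=
  ⟨fun h => (measure_mono fun _ hx => h.trans_lt hx).trans (measure_rearr_lt_le f t),
    fun h => sInf_le h⟩

theorem lt_rearr_iff (f : Ω →ₘ[μ] 𝕜) (t : ℝ) (l : ℝ≥0∞) :
    l < rearr f t ↔ ENNReal.ofReal t < μ {x | l < ‖f x‖ₑ} := by
  simpa only [not_le] using (rearr_le_iff f t l).not

theorem rearr_add_le (f g : Ω →ₘ[μ] 𝕜) (t : ℝ) :
    rearr (f + g) t ≤ rearr f t + eLpNorm g ∞ μ := by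
  rw [rearr_le_iff]
  refine (measure_mono_ae ?_).trans (measure_rearr_lt_le f t)
  have hg : ∀ᵐ x ∂μ, ‖g x‖ₑ ≤ eLpNorm g ∞ μ := by
    rw [eLpNorm_exponent_top]
    exact ae_le_eLpNormEssSup
  filter_upwards [AEEqFun.coeFn_add f g, hg] with x hfg hgx hlt
  by_contra hle
  refine absurd (show rearr f t + eLpNorm g ∞ μ < ‖(f + g) x‖ₑ from hlt) (not_lt.2 ?_)
  rw [hfg]
  exact (enorm_add_le _ _).trans (add_le_add (not_lt.1 hle) hgx)

theorem ofReal_mul_rearr_le_eLpNorm_one (f : Ω →ₘ[μ] 𝕜) (t : ℝ) :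
    ENNReal.ofReal t * rearr f t ≤ eLpNorm f 1 μ := by
  rw [eLpNorm_one_eq_lintegral_enorm]
  refine ENNReal.mul_le_of_forall_lt fun s hs l hl => ?_
  calc s * l ≤ μ {x | l ≤ ‖f x‖ₑ} * l := by
        gcongr
        exact (hs.trans ((lt_rearr_iff f t l).1 hl)).le.trans (measure_mono
          fun x (hx : l < ‖f x‖ₑ) => hx.le)
    _ = l * μ {x | l ≤ ‖f x‖ₑ} := mul_comm _ _
    _ ≤ ∫⁻ x, ‖f x‖ₑ ∂μ := mul_meas_ge_le_lintegral₀ f.stronglyMeasurable.enorm.aemeasurable l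

theorem volume_restrict_Ioo_lt_rearr (f : Ω →ₘ[μ] 𝕜) (t : ℝ) (l : ℝ≥0∞) :
    volume.restrict (Ioo 0 t) {u | l < rearr f u} =
      min (ENNReal.ofReal t) (μ {x | l < ‖f x‖ₑ}) := by
  rw [Measure.restrict_apply' measurableSet_Ioo, inter_comm, ← volume_Ioo_inter_ofReal_lt]
  simp only [lt_rearr_iff]

theorem setLIntegral_enorm_le_lintegral_rearr (f : Ω →ₘ[μ] 𝕜) {t : ℝ} {E : Set Ω}
    (hE : μ E ≤ ENNReal.ofReal t) :
    ∫⁻ x in E, ‖f x‖ₑ ∂μ ≤ ∫⁻ u in Ioo 0 t, rearr f u := by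
  have hf : Measurable fun x => ‖f x‖ₑ := f.stronglyMeasurable.enorm
  rw [lintegral_eq_lintegral_measure_ofReal_lt _ hf.aemeasurable,
    lintegral_eq_lintegral_measure_ofReal_lt _ (antitone_rearr f).measurable.aemeasurable]
  refine lintegral_mono fun s => ?_
  simp only [volume_restrict_Ioo_lt_rearr]
  rw [Measure.restrict_apply (measurableSet_lt measurable_const hf)]
  exact le_min ((measure_mono inter_subset_right).trans hE) (measure_mono inter_subset_left)

theorem ofReal_mul_rearr_le_lintegral_rearr (f : Ω →ₘ[μ] 𝕜) (t : ℝ) :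
    ENNReal.ofReal t * rearr f t ≤ ∫⁻ u in Ioo 0 t, rearr f u :=
  calc ENNReal.ofReal t * rearr f t = ∫⁻ _ in Ioo 0 t, rearr f t := by
        rw [setLIntegral_const, Real.volume_Ioo, sub_zero, mul_comm]
    _ ≤ ∫⁻ u in Ioo 0 t, rearr f u :=
        setLIntegral_mono' measurableSet_Ioo fun u hu => antitone_rearr f hu.2.le

theorem exists_add_eq_eLpNorm_le (f : Ω →ₘ[μ] 𝕜) (t : ℝ) :
    ∃ f₀ f₁ : Ω →ₘ[μ] 𝕜, f = f₀ + f₁ ∧ eLpNorm f₀ 1 μ ≤ ∫⁻ u in Ioo 0 t, rearr f u ∧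
      eLpNorm f₁ ∞ μ ≤ rearr f t := by
  set E := {x | rearr f t < ‖f x‖ₑ}
  have hE : MeasurableSet E := measurableSet_lt measurable_const f.stronglyMeasurable.enorm
  have h₀ : AEStronglyMeasurable (E.indicator f) μ :=
    (f.stronglyMeasurable.indicator hE).aestronglyMeasurable
  have h₁ : AEStronglyMeasurable (Eᶜ.indicator f) μ :=
    (f.stronglyMeasurable.indicator hE.compl).aestronglyMeasurable
  refine ⟨AEEqFun.mk _ h₀, AEEqFun.mk _ h₁, ?_, ?_, ?_⟩
  · rw [AEEqFun.mk_add_mk]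
    simp only [indicator_self_add_compl, AEEqFun.mk_coeFn]
  · rw [eLpNorm_congr_ae (AEEqFun.coeFn_mk _ h₀), eLpNorm_indicator_eq_eLpNorm_restrict hE,
      eLpNorm_one_eq_lintegral_enorm]
    exact setLIntegral_enorm_le_lintegral_rearr f (measure_rearr_lt_le f t)
  · rw [eLpNorm_congr_ae (AEEqFun.coeFn_mk _ h₁), eLpNorm_exponent_top]
    refine essSup_le_of_ae_le _ (.of_forall fun x => ?_)
    by_cases hx : x ∈ E
    · simp [hx]
    · simpa [hx] using not_lt.1 hx

end Rearrangement

namespace QSpace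

variable {M : Type*}

theorem Embeds.refl (X : QSpace M) : X.Embeds X :=
  ⟨Subset.rfl, 1, fun _ _ => (one_mul _).ge⟩

theorem Embeds.trans {X Y Z : QSpace M} (hXY : X.Embeds Y) (hYZ : Y.Embeds Z) : X.Embeds Z := by
  obtain ⟨hsub, C, hC⟩ := hXY
  obtain ⟨hsub', C', hC'⟩ := hYZ
  refine ⟨hsub.trans hsub', C' * C, fun f hf => (hC' f (hsub hf)).trans ?_⟩
  rw [ENNReal.coe_mul, mul_assoc]
  exact mul_le_mul_right (hC f hf) _

theorem ofNorm_embeds_ofNorm {N N' : M → ℝ≥0∞} {C : ℝ≥0} (h : ∀ f, N' f ≤ C * N f) :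
    (ofNorm N).Embeds (ofNorm N') :=
  ⟨fun f hf => (h f).trans_lt (ENNReal.mul_lt_top ENNReal.coe_lt_top hf), C, fun f _ => h f⟩

variable [Add M] {A₀ A₁ B₀ B₁ : QSpace M} {t : ℝ} {f : M}

theorem K_add_le {f₀ f₁ : M} (h₀ : f₀ ∈ A₀.carrier) (h₁ : f₁ ∈ A₁.carrier) (t : ℝ) :
    K A₀ A₁ t (f₀ + f₁) ≤ A₀.qnorm f₀ + ENNReal.ofReal t * A₁.qnorm f₁ :=
  iInf₂_le_of_le f₀ h₀ <| iInf₂_le_of_le f₁ h₁ <| iInf_le_of_le rfl le_rfl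

theorem le_mul_K {c : ℝ≥0} (hc : c ≠ 0) {x : ℝ≥0∞}
    (h : ∀ f₀ ∈ A₀.carrier, ∀ f₁ ∈ A₁.carrier, f = f₀ + f₁ →
      x ≤ c * (A₀.qnorm f₀ + ENNReal.ofReal t * A₁.qnorm f₁)) :
    x ≤ c * K A₀ A₁ t f := by
  have hdiv (y : ℝ≥0∞) : x / c ≤ y ↔ x ≤ c * y :=
    ENNReal.div_le_iff' (by simpa using hc) ENNReal.coe_ne_top
  rw [← hdiv]
  exact le_iInf₂ fun f₀ h₀ => le_iInf₂ fun f₁ h₁ => le_iInf fun e => (hdiv _).2 (h f₀ h₀ f₁ h₁ e)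

theorem mem_sum_of_K_lt_top (h : K A₀ A₁ t f < ∞) : f ∈ sum A₀ A₁ := by
  simp only [K, iInf_lt_iff] at h
  obtain ⟨f₀, h₀, f₁, h₁, e, -⟩ := h
  exact ⟨f₀, h₀, f₁, h₁, e⟩

theorem Embeds.exists_K_le_mul_K (h₀ : A₀.Embeds B₀) (h₁ : A₁.Embeds B₁) :
    ∃ C : ℝ≥0, ∀ t f, K B₀ B₁ t f ≤ C * K A₀ A₁ t f := by
  obtain ⟨hsub₀, C₀, hC₀⟩ := h₀
  obtain ⟨hsub₁, C₁, hC₁⟩ := h₁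
  refine ⟨C₀ + C₁ + 1, fun t f => le_mul_K (by positivity) ?_⟩
  rintro f₀ hf₀ f₁ hf₁ rfl
  have hle₀ : (C₀ : ℝ≥0∞) ≤ ↑(C₀ + C₁ + 1) := by
    rw [add_assoc]; exact_mod_cast le_self_add
  have hle₁ : (C₁ : ℝ≥0∞) ≤ ↑(C₀ + C₁ + 1) := by
    exact_mod_cast le_add_self.trans le_self_add
  calc K B₀ B₁ t (f₀ + f₁) ≤ B₀.qnorm f₀ + ENNReal.ofReal t * B₁.qnorm f₁ :=
        K_add_le (hsub₀ hf₀) (hsub₁ hf₁) t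
    _ ≤ ↑(C₀ + C₁ + 1) * A₀.qnorm f₀ + ENNReal.ofReal t * (↑(C₀ + C₁ + 1) * A₁.qnorm f₁) := by
        gcongr
        · exact (hC₀ f₀ hf₀).trans (mul_le_mul_left hle₀ _)
        · exact (hC₁ f₁ hf₁).trans (mul_le_mul_left hle₁ _)
    _ = ↑(C₀ + C₁ + 1) * (A₀.qnorm f₀ + ENNReal.ofReal t * A₁.qnorm f₁) := by ring

variable {r q : ℝ≥0∞} {a b : ℝ → ℝ}

theorem limitingR_eq_ofNorm (A₀ A₁ : QSpace M) (θ : ℝ) (hq : 0 < q) (hr : 0 < r)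
    (ha : ∀ t, 0 < t → 0 < a t) (hb : ∀ t, 0 < t → 0 < b t) :
    limitingR A₀ A₁ θ r b q a = ofNorm fun f => rNorm (-θ) r b q a fun u => K A₀ A₁ u f := by
  have hmem (f : M) (hf : (rNorm (-θ) r b q a fun u => K A₀ A₁ u f) < ∞) : f ∈ sum A₀ A₁ := by
    obtain ⟨u, -, hu⟩ := exists_lt_top_of_rNorm_lt_top hq hr ha hb hf
    exact mem_sum_of_K_lt_top hu
  simp only [limitingR, ofNorm, mk.injEq, and_true]
  exact Set.ext fun f => and_iff_right_of_imp (hmem f)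

theorem Embeds.limitingR (h₀ : A₀.Embeds B₀) (h₁ : A₁.Embeds B₁) (θ : ℝ) (r : ℝ≥0∞) (b : ℝ → ℝ)
    (q : ℝ≥0∞) (a : ℝ → ℝ) :
    (limitingR A₀ A₁ θ r b q a).Embeds (limitingR B₀ B₁ θ r b q a) := by
  obtain ⟨C, hC⟩ := h₀.exists_K_le_mul_K h₁
  have hnorm (f : M) := rNorm_le_mul (α := -θ) (r := r) (b := b) (q := q) (a := a)
    ENNReal.coe_ne_top fun u _ => hC u f
  refine ⟨?_, C, fun f _ => hnorm f⟩
  rintro f ⟨⟨f₀, hf₀, f₁, hf₁, e⟩, hf⟩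
  exact ⟨⟨f₀, h₀.1 hf₀, f₁, h₁.1 hf₁, e⟩,
    (hnorm f).trans_lt (ENNReal.mul_lt_top ENNReal.coe_lt_top hf)⟩

end QSpace

section Couples

variable {Ω : Type*} [MeasurableSpace Ω] {μ : Measure Ω} {𝕜 : Type*} [RCLike 𝕜]

theorem lorentz_one_top_qnorm (f : Ω →ₘ[μ] 𝕜) :
    (lorentz μ 𝕜 1 ∞).qnorm f = qNorm ∞ (Ioi 0) fun t => ENNReal.ofReal t * rearr f t := by
  simp [lorentz, lorentzKaramata, QSpace.ofNorm, recip, weight]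

variable (μ 𝕜) in
theorem lebesgue_one_embeds_lorentz : (lebesgue μ 𝕜 1).Embeds (lorentz μ 𝕜 1 ∞) := by
  refine QSpace.ofNorm_embeds_ofNorm (C := 1) fun f => ?_
  refine (lorentz_one_top_qnorm f).trans_le ?_
  rw [ENNReal.coe_one, one_mul, qNorm, eLpNorm_exponent_top]
  exact essSup_le_of_ae_le _ (.of_forall fun t => ofReal_mul_rearr_le_eLpNorm_one f t)

/-- The factor `2` pays for `qNorm ∞` being only an essential supremum. -/
theorem ofReal_mul_rearr_le_lorentz (f : Ω →ₘ[μ] 𝕜) {t : ℝ} (ht : 0 < t) :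
    ENNReal.ofReal t * rearr f t ≤ 2 * (lorentz μ 𝕜 1 ∞).qnorm f := by
  set N := (lorentz μ 𝕜 1 ∞).qnorm f with hN
  have hae : ∀ᵐ s ∂volume.restrict (Ioi (0 : ℝ)), ENNReal.ofReal s * rearr f s ≤ N := by
    rw [hN, lorentz_one_top_qnorm, qNorm, eLpNorm_exponent_top]
    exact ae_le_eLpNormEssSup
  obtain ⟨s, hst, hs⟩ : ∃ s ∈ Ioo (t / 2) t, ENNReal.ofReal s * rearr f s ≤ N := by
    have hae' := ae_restrict_of_ae_restrict_of_subset
      (Ioo_subset_Ioi_self.trans (Ioi_subset_Ioi (half_pos ht).le)) hae (s := Ioo (t / 2) t)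
    have hne : (ae (volume.restrict (Ioo (t / 2) t))).NeBot := by
      rw [ae_neBot, Ne, Measure.restrict_eq_zero, Real.volume_Ioo]
      simpa using half_lt_self ht
    exact ((ae_restrict_mem measurableSet_Ioo).and hae').exists
  calc ENNReal.ofReal t * rearr f t ≤ ENNReal.ofReal (2 * s) * rearr f s := by
        gcongr
        · linarith [hst.1]
        · exact antitone_rearr f hst.2.le
    _ = 2 * (ENNReal.ofReal s * rearr f s) := by
        rw [ENNReal.ofReal_mul zero_le_two, ENNReal.ofReal_ofNat, mul_assoc]
    _ ≤ 2 * N := by gcongr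

theorem ofReal_mul_rearr_le_two_mul_K (f : Ω →ₘ[μ] 𝕜) {t : ℝ} (ht : 0 < t) :
    ENNReal.ofReal t * rearr f t ≤
      (2 : ℝ≥0) * QSpace.K (lorentz μ 𝕜 1 ∞) (lebesgue μ 𝕜 ∞) t f := by
  refine QSpace.le_mul_K two_ne_zero ?_
  rintro f₀ - f₁ - rfl
  rw [ENNReal.coe_ofNat, mul_add]
  calc ENNReal.ofReal t * rearr (f₀ + f₁) t
      ≤ ENNReal.ofReal t * (rearr f₀ t + eLpNorm f₁ ∞ μ) := by
        gcongr
        exact rearr_add_le f₀ f₁ t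
    _ = ENNReal.ofReal t * rearr f₀ t + ENNReal.ofReal t * eLpNorm f₁ ∞ μ := mul_add _ _ _
    _ ≤ _ := add_le_add (ofReal_mul_rearr_le_lorentz f₀ ht)
        (le_mul_of_one_le_left zero_le one_le_two)

theorem K_lebesgue_le_two_mul_maxRearr (f : Ω →ₘ[μ] 𝕜) {t : ℝ} (ht : 0 < t) :
    QSpace.K (lebesgue μ 𝕜 1) (lebesgue μ 𝕜 ∞) t f ≤
      (2 : ℝ≥0) * (ENNReal.ofReal t * maxRearr f t) := by
  have hmean : ENNReal.ofReal t * maxRearr f t = ∫⁻ u in Ioo 0 t, rearr f u :=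
    ofReal_mul_mean (rearr f) ht
  rw [hmean]
  rcases eq_or_ne (∫⁻ u in Ioo 0 t, rearr f u) ∞ with htop | hfin
  · simp [htop]
  have hrearr : rearr f t < ∞ := by
    refine lt_top_iff_ne_top.2 fun htop => hfin (top_le_iff.1 ?_)
    simpa [htop, ENNReal.mul_top, ht] using ofReal_mul_rearr_le_lintegral_rearr f t
  obtain ⟨f₀, f₁, e, h₀, h₁⟩ := exists_add_eq_eLpNorm_le f t
  calc QSpace.K (lebesgue μ 𝕜 1) (lebesgue μ 𝕜 ∞) t f
      ≤ eLpNorm f₀ 1 μ + ENNReal.ofReal t * eLpNorm f₁ ∞ μ := by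
        nth_rewrite 1 [e]
        exact QSpace.K_add_le (h₀.trans_lt hfin.lt_top) (h₁.trans_lt hrearr) t
    _ ≤ (∫⁻ u in Ioo 0 t, rearr f u) + ENNReal.ofReal t * rearr f t := by gcongr
    _ ≤ (∫⁻ u in Ioo 0 t, rearr f u) + ∫⁻ u in Ioo 0 t, rearr f u := by
        gcongr
        exact ofReal_mul_rearr_le_lintegral_rearr f t
    _ = (2 : ℝ≥0) * ∫⁻ u in Ioo 0 t, rearr f u := by rw [ENNReal.coe_ofNat, two_mul]

end Couples

section Embeddings

variable {Ω : Type*} [MeasurableSpace Ω] (μ : Measure Ω) (𝕜 : Type*) [RCLike 𝕜]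
  {θ : ℝ} {p r q : ℝ≥0∞} {a b : ℝ → ℝ}

theorem limitingR_lorentz_embeds_starR (hp : recip p = 1 - θ) (hq : 0 < q) (hr : 0 < r)
    (ha : ∀ t, 0 < t → 0 < a t) (hb : ∀ t, 0 < t → 0 < b t) :
    (QSpace.limitingR (lorentz μ 𝕜 1 ∞) (lebesgue μ 𝕜 ∞) θ r b q a).Embeds
      (starR μ 𝕜 p r b q a) := by
  rw [QSpace.limitingR_eq_ofNorm _ _ θ hq hr ha hb]
  refine QSpace.ofNorm_embeds_ofNorm (C := 2) fun f => ?_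
  rw [hp, sub_eq_neg_add, ← rNorm_ofReal_mul]
  exact rNorm_le_mul ENNReal.coe_ne_top fun u hu => ofReal_mul_rearr_le_two_mul_K f hu

theorem starR_embeds_maxR {γ β : ℝ} (ha : HasUpperOrder γ a) (hb : HasUpperOrder β b)
    (hp : recip p + γ + β < 1) : (starR μ 𝕜 p r b q a).Embeds (maxR μ 𝕜 p r b q a) := by
  obtain ⟨C, hC⟩ := exists_rNorm_mean_le r q ha hb hp
  exact QSpace.ofNorm_embeds_ofNorm fun f => hC _ (antitone_rearr f)

theorem maxR_embeds_limitingR_lebesgue (hp : recip p = 1 - θ) (hq : 0 < q) (hr : 0 < r)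
    (ha : ∀ t, 0 < t → 0 < a t) (hb : ∀ t, 0 < t → 0 < b t) :
    (maxR μ 𝕜 p r b q a).Embeds
      (QSpace.limitingR (lebesgue μ 𝕜 1) (lebesgue μ 𝕜 ∞) θ r b q a) := by
  rw [QSpace.limitingR_eq_ofNorm _ _ θ hq hr ha hb]
  refine QSpace.ofNorm_embeds_ofNorm (C := 2) fun f => ?_
  rw [hp, sub_eq_neg_add, ← rNorm_ofReal_mul]
  exact rNorm_le_mul ENNReal.coe_ne_top fun u hu => K_lebesgue_le_two_mul_maxRearr f hu

theorem grandStar_eq_starR (p q r : ℝ≥0∞) (b : ℝ → ℝ) :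
    grandStar μ 𝕜 p q r b = starR μ 𝕜 p r b q fun _ => 1 := by
  simp only [grandStar, starR, rNorm, weight, mul_one]

theorem grandMax_eq_maxR (p q r : ℝ≥0∞) (b : ℝ → ℝ) :
    grandMax μ 𝕜 p q r b = maxR μ 𝕜 p r b q fun _ => 1 := by
  simp only [grandMax, maxR, rNorm, weight, mul_one]

end Embeddings

end LorentzKaramata

open LorentzKaramata in
theorem theorem6p4_general {Ω : Type*} [MeasurableSpace Ω] (μ : Measure Ω) (𝕜 : Type*) [RCLike 𝕜]
    {θ : ℝ} (hθ1 : θ ≤ 1) {p : ℝ≥0∞} (hp : p = 1 / ENNReal.ofReal (1 - θ))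
    {q r : ℝ≥0∞} (hq : 0 < q) (hr : 0 < r) {a b : ℝ → ℝ} {γ β : ℝ}
    (ha : HasUpperOrder γ a) (hb : HasUpperOrder β b) (hγβ : γ + β < θ) :
    (QSpace.limitingR (lebesgue μ 𝕜 1) (lebesgue μ 𝕜 ∞) θ r b q a).Identical
        (QSpace.limitingR (lorentz μ 𝕜 1 ∞) (lebesgue μ 𝕜 ∞) θ r b q a) ∧
      (QSpace.limitingR (lorentz μ 𝕜 1 ∞) (lebesgue μ 𝕜 ∞) θ r b q a).Identical
        (maxR μ 𝕜 p r b q a) ∧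
      (maxR μ 𝕜 p r b q a).Identical (starR μ 𝕜 p r b q a) := by
  have hp' : recip p = 1 - θ := by
    rw [hp, recip, one_div, inv_inv, ENNReal.toReal_ofReal (sub_nonneg.2 hθ1)]
  have h₁ := (lebesgue_one_embeds_lorentz μ 𝕜).limitingR (.refl (lebesgue μ 𝕜 ∞)) θ r b q a
  have h₂ := limitingR_lorentz_embeds_starR μ 𝕜 hp' hq hr ha.pos hb.pos
  have h₃ := starR_embeds_maxR μ 𝕜 (p := p) (r := r) (q := q) ha hb (by linarith)
  have h₄ := maxR_embeds_limitingR_lebesgue μ 𝕜 hp' hq hr ha.pos hb.pos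
  exact ⟨⟨h₁, h₂.trans (h₃.trans h₄)⟩, ⟨h₂.trans h₃, h₄.trans h₁⟩, ⟨h₄.trans (h₁.trans h₂), h₃⟩⟩

open LorentzKaramata in
theorem theorem6p4 {Ω : Type*} [MeasurableSpace Ω] (μ : Measure Ω) [SigmaFinite μ]
    (hμ : IsNonatomic μ) (𝕜 : Type*) [RCLike 𝕜]
    (θ : ℝ) (hθ0 : 0 < θ) (hθ1 : θ ≤ 1)
    (p : ℝ≥0∞) (hp : p = 1 / ENNReal.ofReal (1 - θ))
    (q r : ℝ≥0∞) (hq : 0 < q) (hr : 0 < r)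
    (a b : ℝ → ℝ) (ha : IsSlowlyVarying a) (hb : IsSlowlyVarying b) :
    ((QSpace.limitingR (lebesgue μ 𝕜 1) (lebesgue μ 𝕜 ∞) θ r b q a).Identical
        (QSpace.limitingR (lorentz μ 𝕜 1 ∞) (lebesgue μ 𝕜 ∞) θ r b q a) ∧
      (QSpace.limitingR (lorentz μ 𝕜 1 ∞) (lebesgue μ 𝕜 ∞) θ r b q a).Identical
        (maxR μ 𝕜 p r b q a) ∧
      (maxR μ 𝕜 p r b q a).Identical (starR μ 𝕜 p r b q a)) ∧
    ((QSpace.limitingR (lebesgue μ 𝕜 1) (lebesgue μ 𝕜 ∞) θ r b q fun _ => 1).Identical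
        (QSpace.limitingR (lorentz μ 𝕜 1 ∞) (lebesgue μ 𝕜 ∞) θ r b q fun _ => 1) ∧
      (QSpace.limitingR (lorentz μ 𝕜 1 ∞) (lebesgue μ 𝕜 ∞) θ r b q fun _ => 1).Identical
        (grandMax μ 𝕜 p q r b) ∧
      (grandMax μ 𝕜 p q r b).Identical (grandStar μ 𝕜 p q r b)) := by
  have hb' : HasUpperOrder (θ / 3) b := hb.hasUpperOrder (by positivity)
  rw [grandStar_eq_starR, grandMax_eq_maxR]
  exact ⟨theorem6p4_general μ 𝕜 hθ1 hp hq hr (ha.hasUpperOrder (by positivity : 0 < θ / 3)) hb'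
      (by linarith),
    theorem6p4_general μ 𝕜 hθ1 hp hq hr (hasUpperOrder_one le_rfl) hb' (by linarith)⟩
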